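/- Let $q$ be a prime power, $m\geq 1$ an integer, $n=2m$, and $\alpha$ a primitive element of $\mathbb{F}_{q^n}$. For $0\le u\le q^n-1$ with $q$-ary expansion $u=\sum_{i=0}^{n-1}u_iq^i$, $u_i\in\{0,\dots,q-1\}$, put $\mathrm{wt}_q(u)=\sum_i u_i$, $O(u)=\sum_{i\text{ odd}}u_i$ and $E(u)=\sum_{i\text{ even}}u_i$. For $1\le r'<n(q-1)$ let $M_{r'}=\{0\le k\le m(q-1): k\equiv r' \pmod 2\}$ and, for $I\subseteq M_{r'}$, let $$Z_{r',I}=\{\alpha^u : 0<u\le q^n-1,\ \mathrm{wt}_q(u)\le n(q-1)-r'-1\}\cup\bigcup_{k\in M_{r'}\setminus I}\{\alpha^u : 0\le u\le q^n-1,\ \mathrm{wt}_q(u)=n(q-1)-r',\ |O(u)-E(u)|=k\}.$$ Let $C_q(r',I,n)^*$ be the cyclic code of length $q^n-1$ over $\mathbb{F}_q$ with zero set $Z_{r',I}$, i.e. the set of words $(x_g)_{g\in\mathbb{F}_{q^n}^*}$ over $\mathbb{F}_q$ with $\sum_{g} x_g g^u=0$ whenever $\alpha^u\in Z_{r',I}$,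 and let the sandwiched Reed--Muller code $C_q(r',I,n)\subseteq\mathbb{F}_q^{q^n}$ be its extended code, obtained by adding to each word the symbol $x_0=-\sum_{g\neq 0}x_g$ at the position labelled $0$. Let $\mathrm{dist}$ denote the minimum Hamming distance. Theorem. Let $0\le r\le n(q-1)-2$ and write $r=\rho(q-1)+s$ with $0\le\rho\le n-1$ and $0\le s<q-1$. Let $I\subseteq M_{r+1}$. Below, $\{q-1-s\pm1\}$ denotes $\{q-1-s+1,\,q-1-s-1\}$ and $\{|s\pm1|\}$ denotes $\{|s+1|,\,|s-1|\}$. 1. If $\rho=n-1$ and $\{q-1-s-1\}\cap I=\emptyset$, then $\mathrm{dist}(C_q(r+1,I,n))=q-s$. 2. Let $0\le\rho\le n-2$. (a) If $\rho$ is odd and $\{q-1-s\pm1\}\cap I=\emptyset$, or $\rho$ is even and $\{|s\pm1|\}\cap I=\emptyset$, then $\mathrm{dist}(C_q(r+1,I,n))=(q-s)q^{n-\rho-1}$. (b) If $\rho$ is odd and $\{q-1-s\pm1\}\cap I=\{q-1-s+1\}$, or $\rho$ is even, $s\ne0$ and $\{|s\pm1|\}\cap I=\{|s-1|\}$, then $\mathrm{dist}(C_q(r+1,I,n))\ge(q^2-qs-1)q^{n-\rho-2}$.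 -/

import Mathlib

namespace SandwichedRM

/-- The `i`-th digit `u_i` of the `q`-ary expansion `u = ∑ u_i q ^ i`. -/
def digit (q u i : ℕ) : ℕ := u / q ^ i % q

/-- The `q`-weight `wt_q(u)` of `u`, for `0 ≤ u ≤ q ^ n - 1`. -/
def wt (q n u : ℕ) : ℕ := ∑ i ∈ Finset.range n, digit q u i

/-- `O(u)`: the sum of the `q`-ary digits of `u` at the odd positions. -/
def oddSum (q n u : ℕ) : ℕ := ∑ i ∈ (Finset.range n).filter (fun i => Odd i), digit q u i

/-- `E(u)`: the sum of the `q`-ary digits of `u` at the even positions. -/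
def evenSum (q n u : ℕ) : ℕ := ∑ i ∈ (Finset.range n).filter (fun i => Even i), digit q u i

/-- `M_r`: the integers `0 ≤ k ≤ m (q - 1)` of the same parity as `r`. -/
def M (q m r : ℕ) : Set ℕ := {k | k ≤ m * (q - 1) ∧ (Even k ↔ Even r)}

section ZeroSets

variable {K : Type*} [Field K]

/-- `Z_r = {α ^ u | 0 < u ≤ q ^ n - 1, wt_q(u) ≤ n (q - 1) - r - 1}`, for `r ≥ 0`. -/
def Z (q n : ℕ) (α : K) (r : ℕ) : Set K :=
  {β | ∃ u : ℕ, 0 < u ∧ u ≤ q ^ n - 1 ∧ wt q n u + r + 1 ≤ n * (q - 1) ∧ β = α ^ u}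

/-- `Θ_k^{(r)} = {α ^ u | 0 ≤ u ≤ q ^ n - 1, wt_q(u) = n (q - 1) - r, |O(u) - E(u)| = k}`. -/
def Θ (q n : ℕ) (α : K) (r k : ℕ) : Set K :=
  {β | ∃ u : ℕ, u ≤ q ^ n - 1 ∧ wt q n u + r = n * (q - 1) ∧
    |(oddSum q n u : ℤ) - (evenSum q n u : ℤ)| = (k : ℤ) ∧ β = α ^ u}

/-- `Z_{r,I} = Z_r ∪ ⋃_{k ∈ M_r ∖ I} Θ_k^{(r)}`, where `n = 2 m`. -/
def ZI (q m : ℕ) (α : K) (r : ℕ) (I : Set ℕ) : Set K :=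
  Z q (2 * m) α r ∪ ⋃ k ∈ M q m r \ I, Θ q (2 * m) α r k

end ZeroSets

section Codes

variable {F K : Type*} [Field F] [Field K] [Algebra F K] [Fintype K] [DecidableEq K]

/-- The map `ρ_s : ∑ x_g (g) ↦ ∑ x_g g ^ s`. A word of length `|K| - 1` over `F` is a family of
symbols `x_g` indexed by the nonzero elements `g` of `K`. -/
def powerSum (s : ℕ) (x : Kˣ → F) : K := ∑ g : Kˣ, algebraMap F K (x g) * (g : K) ^ s

/-- The cyclic code whose zeros are the elements `α ^ u` of `S`: the words `x` such that
`ρ_u(x) = 0` whenever `α ^ u ∈ S`. -/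
def cyclicCode (F : Type*) [Field F] [Algebra F K] (α : K) (S : Set K) :
    Submodule F (Kˣ → F) where
  carrier := {x | ∀ u : ℕ, α ^ u ∈ S → powerSum u x = 0}
  zero_mem' := by
    intro u _
    simp [powerSum]
  add_mem' := by
    intro x y hx hy u hu
    have h1 := hx u hu
    have h2 := hy u hu
    simp only [powerSum] at h1 h2 ⊢
    simp [add_mul, Finset.sum_add_distrib, h1, h2]
  smul_mem' := by
    intro c x hx u hu
    have h1 := hx u hu
    simp only [powerSum] at h1 ⊢
    simp [mul_assoc, ← Finset.mul_sum, h1]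

/-- The extension of a word by the symbol `-∑ x_g` at the position labelled `0`. -/
def extendWord : (Kˣ → F) →ₗ[F] (K → F) where
  toFun x g := if h : g = 0 then -∑ a : Kˣ, x a else x (Units.mk0 g h)
  map_add' := by
    intro x y
    funext g
    by_cases h : g = 0
    · simp [h, Finset.sum_add_distrib, add_comm]
    · simp [h]
  map_smul' := by
    intro c x
    funext g
    by_cases h : g = 0
    · simp [h, Finset.mul_sum]
    · simp [h]

/-- The sandwiched Reed-Muller code `C_q(r, I, n)` with `n = 2 m`, for `0 ≤ r < n (q - 1)`: the
extended code of the cyclic code with zero set `Z_{r,I}`. Here `F` is the field with `q` elements,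
`K` its extension of degree `n`, and `α` a primitive element of `K`. -/
def sandwichedCode (F : Type*) [Field F] [Algebra F K] (q m : ℕ) (α : K) (r : ℕ) (I : Set ℕ) :
    Submodule F (K → F) :=
  (cyclicCode F α (ZI q m α r I)).map extendWord

end Codes

/-- The minimum Hamming distance between two distinct codewords of `C`. -/
noncomputable def minDist {ι F : Type*} [Fintype ι] [Field F] [DecidableEq F]
    (C : Submodule F (ι → F)) : ℕ :=
  sInf {d | ∃ x ∈ C, ∃ y ∈ C, x ≠ y ∧ hammingDist x y = d}

end SandwichedRM

/-!
The sandwiched code lies between two Reed-Muller codes: `RM(r) ⊆ C_q(r + 1, I, n) ⊆ RM(r + 1)`.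
Write `K = n - ρ - 1`.

*Lower bounds.* These are BCH bounds. If `∑ x_g g ^ u = 0` for all `u < d`, then testing `x` against
`∏ (X - g)`, with `g` over all points but one of its support, shows that the weight exceeds `d`
(`lt_hammingNorm_of_sum_pow_eq_zero`). So it is enough to see that consecutive exponents are zeros.
The number `(q - s) q ^ K - 1` has the digits `q - 1, …, q - 1, q - 1 - s`, of weight
`n (q - 1) - r`. A smaller `u` has smaller weight, and when its weight is only one less, exactly one
of those digits has been lowered by one, so that the alternating digit sum `E(u) - O(u)` is that of
`(q - s) q ^ K - 1` plus or minus one (`weight_lt_and_altSum_of_lt`). This leaves the two values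
`q - 1 - s ± 1` or `|s ± 1|` according to the parity of `ρ`, and when `I` avoids both, all these
exponents are zeros. The first exponent at which the other sign occurs is
`(q ^ 2 - q s - 1) q ^ (K - 1) - 1`, where the second digit from the top is lowered
(`altSum_of_lt_second`); this is the bound when `I` contains only the value arising there.

*Upper bound.* In coordinates over `F`, the function
`∏_{j < ρ} (1 - x_j ^ (q - 1)) ∏_{a ∈ S} (x_ρ - a)` with `|S| = s` is a polynomial of degree `r` with
`(q - s) q ^ K` nonzero values. A power `g ^ u` is a polynomial of degree `wt_q(u)` in the
coordinates of `g`, since each `g ↦ g ^ (q ^ i)` is linear. So the power sums of exponents of weight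
less than `n (q - 1) - r` vanish, as do all sums over `F ^ n` of polynomials of degree less than
`n (q - 1)` (`sum_eval_algebraMap_eq_zero`).
-/

namespace SandwichedRM

/-! ### Digits -/

lemma digit_zero_right (q u : ℕ) : digit q u 0 = u % q := by simp [digit]

lemma digit_succ (q u i : ℕ) : digit q u (i + 1) = digit q (u / q) i := by
  simp [digit, pow_succ', Nat.div_div_eq_div_mul]

lemma digit_zero_left (q i : ℕ) : digit q 0 i = 0 := by simp [digit]

lemma digit_le (q u i : ℕ) (hq : 0 < q) : digit q u i ≤ q - 1 :=
  Nat.le_sub_one_of_lt (Nat.mod_lt _ hq)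

lemma wt_succ (q n u : ℕ) : wt q (n + 1) u = u % q + wt q n (u / q) := by
  simp [wt, Finset.sum_range_succ', digit_succ, digit_zero_right, add_comm]

lemma wt_zero_right (q n : ℕ) : wt q n 0 = 0 := by simp [wt, digit_zero_left]

lemma sum_digit_mul_pow (q n u : ℕ) : ∑ i ∈ Finset.range n, digit q u i * q ^ i = u % q ^ n := by
  induction n with
  | zero => simp [Nat.mod_one]
  | succ n ih => rw [Finset.sum_range_succ, ih, Nat.mod_pow_succ, digit, mul_comm (q ^ n)]

/-- The alternating digit sum `∑ (-1) ^ i u_i`. -/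
def altSum (q n u : ℕ) : ℤ := ∑ i ∈ Finset.range n, (-1) ^ i * (digit q u i : ℤ)

lemma altSum_succ (q n u : ℕ) :
    altSum q (n + 1) u = ((u % q : ℕ) : ℤ) - altSum q n (u / q) := by
  simp only [altSum, Finset.sum_range_succ', digit_succ, digit_zero_right, pow_succ, pow_zero]
  rw [add_comm, sub_eq_add_neg, ← Finset.sum_neg_distrib]
  simp

lemma altSum_zero_right (q n : ℕ) : altSum q n 0 = 0 := by simp [altSum, digit_zero_left]

lemma altSum_eq (q n u : ℕ) : altSum q n u = (evenSum q n u : ℤ) - oddSum q n u := by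
  simp only [altSum, evenSum, oddSum, Nat.cast_sum, Finset.sum_filter]
  rw [← Finset.sum_sub_distrib]
  refine Finset.sum_congr rfl fun i _ => ?_
  rcases Nat.even_or_odd i with h | h
  · simp [h, h.neg_one_pow, Nat.not_odd_iff_even.mpr h]
  · simp [h, h.neg_one_pow, Nat.not_even_iff_odd.mpr h]

lemma oddSum_add_evenSum (q n u : ℕ) : oddSum q n u + evenSum q n u = wt q n u := by
  simp only [wt, evenSum, oddSum, Finset.sum_filter]
  rw [← Finset.sum_add_distrib]
  refine Finset.sum_congr rfl fun i _ => ?_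
  rcases Nat.even_or_odd i with h | h
  · simp [h, Nat.not_odd_iff_even.mpr h]
  · simp [h, Nat.not_even_iff_odd.mpr h]

lemma card_filter_odd_range (m : ℕ) :
    ((Finset.range (2 * m)).filter (fun i => Odd i)).card = m := by
  induction m with
  | zero => simp
  | succ m ih =>
    rw [show 2 * (m + 1) = 2 * m + 1 + 1 by ring, Finset.range_add_one, Finset.range_add_one,
      Finset.filter_insert, Finset.filter_insert]
    simp [ih, show ¬ Odd (2 * m) by simp]

lemma card_filter_even_range (m : ℕ) :
    ((Finset.range (2 * m)).filter (fun i => Even i)).card = m := by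
  induction m with
  | zero => simp
  | succ m ih =>
    rw [show 2 * (m + 1) = 2 * m + 1 + 1 by ring, Finset.range_add_one, Finset.range_add_one,
      Finset.filter_insert, Finset.filter_insert]
    simp [ih]

lemma oddSum_le (q m u : ℕ) (hq : 0 < q) : oddSum q (2 * m) u ≤ m * (q - 1) := by
  have h := Finset.sum_le_card_nsmul _ (digit q u) (q - 1)
    (fun i (_ : i ∈ (Finset.range (2 * m)).filter (fun i => Odd i)) => digit_le q u i hq)
  rwa [card_filter_odd_range, smul_eq_mul] at h

lemma evenSum_le (q m u : ℕ) (hq : 0 < q) : evenSum q (2 * m) u ≤ m * (q - 1) := by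
  have h := Finset.sum_le_card_nsmul _ (digit q u) (q - 1)
    (fun i (_ : i ∈ (Finset.range (2 * m)).filter (fun i => Even i)) => digit_le q u i hq)
  rwa [card_filter_even_range, smul_eq_mul] at h

/-- The value `|O(u) - E(u)|` automatically belongs to `M_r` when `wt_q(u) = n (q - 1) - r`. -/
lemma natAbs_altSum_mem_M (q m u r : ℕ) (hq : 0 < q) (h : wt q (2 * m) u + r = 2 * m * (q - 1)) :
    (altSum q (2 * m) u).natAbs ∈ M q m r := by
  have h1 := oddSum_le q m u hq
  have h2 := evenSum_le q m u hq
  have h3 := oddSum_add_evenSum q (2 * m) u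
  have h4 := altSum_eq q (2 * m) u
  rw [mul_assoc] at h
  refine ⟨by omega, ?_⟩
  rw [Nat.even_iff, Nat.even_iff]
  omega

/-! ### Exponents below the BCH bound -/

/-- The alternating digit sum of `(q - s) q ^ K - 1`. -/
def maxAltSum (q s : ℕ) (K : ℕ) : ℤ := if Even K then (q : ℤ) - 1 - s else s

lemma maxAltSum_succ (q s K : ℕ) : maxAltSum q s (K + 1) = (q : ℤ) - 1 - maxAltSum q s K := by
  unfold maxAltSum
  by_cases h : Even K <;> simp [h, Nat.even_add_one]

/-- Among the `u < (q - s) q ^ K` the weight is largest exactly at `(q - s) q ^ K - 1`. -/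
lemma wt_le_of_lt (q s : ℕ) (hs : s < q - 1) (K n u : ℕ) (hu : u + 1 ≤ (q - s) * q ^ K)
    (hn : K < n) :
    wt q n u ≤ K * (q - 1) + (q - 1 - s) ∧
      (wt q n u = K * (q - 1) + (q - 1 - s) →
        u + 1 = (q - s) * q ^ K ∧ altSum q n u = maxAltSum q s K) := by
  induction K generalizing n u with
  | zero =>
    obtain ⟨n, rfl⟩ : ∃ n', n = n' + 1 := ⟨n - 1, by omega⟩
    rw [pow_zero, mul_one] at hu ⊢
    have hlt : u < q := by omega
    rw [wt_succ, altSum_succ, Nat.mod_eq_of_lt hlt, Nat.div_eq_of_lt hlt, wt_zero_right,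
      altSum_zero_right, maxAltSum, if_pos Even.zero]
    refine ⟨by omega, fun h => ⟨by omega, by omega⟩⟩
  | succ K ih =>
    obtain ⟨n, rfl⟩ : ∃ n', n = n' + 1 := ⟨n - 1, by omega⟩
    have hq : 0 < q := by omega
    have hd : u % q < q := Nat.mod_lt _ hq
    have hdm := Nat.div_add_mod u q
    have hu' : u / q + 1 ≤ (q - s) * q ^ K := by
      rw [Nat.succ_le_iff, Nat.div_lt_iff_lt_mul hq, mul_assoc, ← pow_succ]
      omega
    obtain ⟨h1, h2⟩ := ih n (u / q) hu' (by omega)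
    rw [wt_succ, altSum_succ, maxAltSum_succ, add_mul, one_mul]
    refine ⟨by omega, fun h => ?_⟩
    obtain ⟨h3, h4⟩ := h2 (by omega)
    have h5 : u % q = q - 1 := by omega
    refine ⟨?_, by rw [h4]; omega⟩
    rw [pow_succ', mul_left_comm, ← h3, mul_add]
    omega

/-- Below `(q - s) q ^ K - 1` the weight drops, and where it drops by one only, the alternating
digit sum changes by one. -/
lemma weight_lt_and_altSum_of_lt (q s : ℕ) (hs : s < q - 1) (K n u : ℕ)
    (hu : u + 1 < (q - s) * q ^ K) (hn : K < n) :
    wt q n u < K * (q - 1) + (q - 1 - s) ∧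
      (wt q n u + 1 = K * (q - 1) + (q - 1 - s) →
        altSum q n u = maxAltSum q s K - 1 ∨ altSum q n u = maxAltSum q s K + 1) := by
  obtain ⟨h1, h2⟩ := wt_le_of_lt q s hs K n u hu.le hn
  refine ⟨lt_of_le_of_ne h1 fun h => hu.ne (h2 h).1, ?_⟩
  clear h1 h2
  replace hu := hu.le
  induction K generalizing n u with
  | zero =>
    obtain ⟨n, rfl⟩ : ∃ n', n = n' + 1 := ⟨n - 1, by omega⟩
    rw [pow_zero, mul_one] at hu
    have hlt : u < q := by omega
    rw [wt_succ, altSum_succ, Nat.mod_eq_of_lt hlt, Nat.div_eq_of_lt hlt, wt_zero_right,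
      altSum_zero_right, maxAltSum, if_pos Even.zero]
    intro h
    left
    omega
  | succ K ih =>
    obtain ⟨n, rfl⟩ : ∃ n', n = n' + 1 := ⟨n - 1, by omega⟩
    have hq : 0 < q := by omega
    have hd : u % q < q := Nat.mod_lt _ hq
    have hu' : u / q + 1 ≤ (q - s) * q ^ K := by
      rw [Nat.succ_le_iff, Nat.div_lt_iff_lt_mul hq, mul_assoc, ← pow_succ]
      omega
    obtain ⟨h1, h2⟩ := wt_le_of_lt q s hs K n (u / q) hu' (by omega)
    have h3 := ih n (u / q) (by omega) hu'
    rw [wt_succ, altSum_succ, maxAltSum_succ, add_mul, one_mul]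
    intro h
    -- Either the lowest digit is lowered and `u / q` is extremal, or the lowest digit is `q - 1`.
    rcases Nat.lt_or_ge (u % q) (q - 1) with h4 | h4
    · obtain ⟨-, h5⟩ := h2 (by omega)
      omega
    · have := h3 (by omega)
      omega

/-- Below `(q ^ 2 - q s - 1) q ^ K - 1`, a weight drop by one can occur in the top digit only. -/
lemma altSum_of_lt_second (q s : ℕ) (hs : s < q - 1) (K n u : ℕ)
    (hu : u + 1 < (q ^ 2 - q * s - 1) * q ^ K) (hn : K + 1 < n)
    (hwt : wt q n u + 1 = (K + 1) * (q - 1) + (q - 1 - s)) :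
    altSum q n u = maxAltSum q s (K + 1) + if Even K then 1 else -1 := by
  have hq : 0 < q := by omega
  have hA : q ^ 2 - q * s - 1 + 1 = (q - s) * q := by
    have : 0 < (q - s) * q := Nat.mul_pos (by omega) hq
    have h : q ^ 2 - q * s = (q - s) * q := by rw [Nat.sub_mul, sq, mul_comm s]
    omega
  induction K generalizing n u with
  | zero =>
    obtain ⟨n, rfl⟩ : ∃ n', n = n' + 1 := ⟨n - 1, by omega⟩
    rw [pow_zero, mul_one] at hu
    have hd : u % q < q := Nat.mod_lt _ hq
    have hdm := Nat.div_add_mod u q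
    have hu' : u / q + 1 ≤ (q - s) * q ^ 0 := by
      rw [Nat.succ_le_iff, Nat.div_lt_iff_lt_mul hq, pow_zero, mul_one]
      omega
    obtain ⟨h1, h2⟩ := wt_le_of_lt q s hs 0 n (u / q) hu' (by omega)
    rw [wt_succ, zero_add, one_mul] at hwt
    rw [zero_mul, zero_add] at h1 h2
    rw [pow_zero, mul_one] at h2 hu'
    rw [altSum_succ, maxAltSum, if_neg (by decide), if_pos Even.zero]
    have hne : wt q n (u / q) ≠ q - 1 - s := by
      intro h
      have h3 := (h2 h).1
      have h4 : u % q = q - 2 := by omega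
      have h5 : q * (u / q + 1) = (q - s) * q := by rw [h3, mul_comm]
      rw [mul_add] at h5
      omega
    obtain ⟨n, rfl⟩ : ∃ n', n = n' + 1 := ⟨n - 1, by omega⟩
    have hlt : u / q < q := by omega
    rw [wt_succ, Nat.mod_eq_of_lt hlt, Nat.div_eq_of_lt hlt, wt_zero_right] at hwt h1 hne
    rw [altSum_succ, Nat.mod_eq_of_lt hlt, Nat.div_eq_of_lt hlt, altSum_zero_right]
    omega
  | succ K ih =>
    obtain ⟨n, rfl⟩ : ∃ n', n = n' + 1 := ⟨n - 1, by omega⟩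
    have hd : u % q < q := Nat.mod_lt _ hq
    have hdm := Nat.div_add_mod u q
    have hpos : 0 < q ^ K := Nat.pow_pos hq
    have hle : u / q + 1 ≤ (q ^ 2 - q * s - 1) * q ^ K := by
      rw [Nat.succ_le_iff, Nat.div_lt_iff_lt_mul hq, mul_assoc, ← pow_succ]
      omega
    have hlt : u / q + 1 < (q - s) * q ^ (K + 1) := by
      rw [pow_succ', ← mul_assoc, ← hA, add_mul, one_mul]
      omega
    have h1 := (weight_lt_and_altSum_of_lt q s hs (K + 1) n (u / q) hlt (by omega)).1
    rw [wt_succ] at hwt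
    have h2 : (K + 1 + 1) * (q - 1) = (K + 1) * (q - 1) + (q - 1) := by ring
    -- `u / q` cannot have maximal weight, so the lowest digit of `u` is `q - 1`.
    have h3 : u % q = q - 1 := by omega
    have h4 : u / q + 1 < (q ^ 2 - q * s - 1) * q ^ K := by
      refine lt_of_le_of_ne hle fun h => hu.ne ?_
      rw [pow_succ' q K, mul_left_comm, ← h, mul_add]
      omega
    have h5 := ih n (u / q) h4 (by omega) (by omega)
    rw [altSum_succ, maxAltSum_succ, h5, h3]
    by_cases hK : Even K
    · simp only [hK, Nat.even_add_one, not_true, if_true, if_false]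
      omega
    · simp only [hK, Nat.even_add_one, not_false_iff, if_true, if_false]
      omega

/-! ### The BCH bound -/

lemma extendWord_apply_unit {F K : Type*} [Field F] [Field K] [Fintype K] [DecidableEq K]
    (x : Kˣ → F) (g : Kˣ) : extendWord x (g : K) = x g := by
  simp [extendWord]

lemma extendWord_apply_zero {F K : Type*} [Field F] [Field K] [Fintype K] [DecidableEq K]
    (x : Kˣ → F) : extendWord x (0 : K) = -∑ g, x g := by
  simp [extendWord]

section BCH

variable {F K : Type*} [Field F] [Field K] [Algebra F K] [Fintype K] [DecidableEq K]

/-- The BCH bound for words on all of `K`: vanishing of the first `d` power sums forces the weight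
to exceed `d`. -/
lemma lt_hammingNorm_of_sum_pow_eq_zero [DecidableEq F] (x : K → F) (hx : x ≠ 0) (d : ℕ)
    (h : ∀ u < d, ∑ g, algebraMap F K (x g) * g ^ u = 0) : d < hammingNorm x := by
  obtain ⟨g₀, hg₀⟩ := Function.ne_iff.mp hx
  by_contra! hle
  set S := Finset.univ.filter fun g => x g ≠ 0 with hS
  have hcard : S.card ≤ d := hle
  have hmem : g₀ ∈ S := by simpa [hS] using hg₀
  let p : Polynomial K := ∏ g ∈ S.erase g₀, (Polynomial.X - Polynomial.C g)
  have hdeg : p.natDegree < d := by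
    have h1 : p.natDegree = (S.erase g₀).card := by
      simp only [p, Polynomial.natDegree_finsetProd_X_sub_C_eq_card]
    rw [h1]
    exact (Finset.card_erase_lt_of_mem hmem).trans_le hcard
  have hzero : ∑ g, algebraMap F K (x g) * p.eval g = 0 := by
    simp_rw [Polynomial.eval_eq_sum_range, Finset.mul_sum]
    rw [Finset.sum_comm]
    refine Finset.sum_eq_zero fun u hu => ?_
    rw [Finset.mem_range] at hu
    calc ∑ g, algebraMap F K (x g) * (p.coeff u * g ^ u)
        = p.coeff u * ∑ g, algebraMap F K (x g) * g ^ u := by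
          rw [Finset.mul_sum]
          exact Finset.sum_congr rfl fun g _ => by ring
      _ = 0 := by rw [h u (by omega), mul_zero]
  rw [Finset.sum_eq_single g₀] at hzero
  · rcases mul_eq_zero.mp hzero with h1 | h1
    · exact hg₀ (by simpa using h1)
    · simp only [p, Polynomial.eval_prod, Polynomial.eval_sub, Polynomial.eval_X,
        Polynomial.eval_C, Finset.prod_eq_zero_iff, sub_eq_zero] at h1
      obtain ⟨a, ha, rfl⟩ := h1
      simp at ha
  · intro g _ hg
    by_cases hxg : x g = 0
    · simp [hxg]
    · have : p.eval g = 0 := by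
        simp only [p, Polynomial.eval_prod]
        exact Finset.prod_eq_zero (i := g) (by simp [hS, hg, hxg]) (by simp)
      rw [this, mul_zero]
  · simp

lemma sum_eq_zero_position_add_powerSum (x : K → F) (u : ℕ) :
    ∑ g, algebraMap F K (x g) * g ^ u =
      algebraMap F K (x 0) * 0 ^ u + powerSum u (fun g : Kˣ => x g) := by
  rw [← Finset.add_sum_erase _ _ (Finset.mem_univ (0 : K)), powerSum]
  congr 1
  refine (Finset.sum_nbij' (fun g : Kˣ => (g : K))
    (fun g => if h : g = 0 then 1 else Units.mk0 g h) ?_ ?_ ?_ ?_ ?_).symm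
  · simp
  · simp
  · intro g _
    simp
  · intro g hg
    simp [Finset.ne_of_mem_erase hg]
  · simp

/-- Power sums over all of `K` of an extended codeword vanish, for the exponent `0` by the choice of
the extension symbol. -/
lemma sum_pow_eq_zero_of_mem_sandwichedCode {q m r : ℕ} {α : K} {I : Set ℕ} {x : K → F}
    (hx : x ∈ sandwichedCode F q m α r I) (u : ℕ) (hu : 0 < u → α ^ u ∈ ZI q m α r I) :
    ∑ g, algebraMap F K (x g) * g ^ u = 0 := by
  obtain ⟨c, hc, rfl⟩ := hx
  rw [sum_eq_zero_position_add_powerSum]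
  simp only [extendWord_apply_unit, extendWord_apply_zero]
  rcases Nat.eq_zero_or_pos u with rfl | hpos
  · simp [powerSum]
  · rw [zero_pow hpos.ne', mul_zero, zero_add]
    exact hc u (hu hpos)

end BCH

/-- Nonzero exponents of smaller weight, and those of weight `n (q - 1) - r` for which
`|O(u) - E(u)|` is not in `I`, are zeros. -/
lemma pow_mem_ZI {K : Type*} [Field K] (q m : ℕ) (α : K) (r : ℕ) (I : Set ℕ) (u : ℕ) (hq : 0 < q)
    (hu0 : 0 < u) (hu : u ≤ q ^ (2 * m) - 1) (hwt : wt q (2 * m) u + r ≤ 2 * m * (q - 1))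
    (hI : wt q (2 * m) u + r = 2 * m * (q - 1) → (altSum q (2 * m) u).natAbs ∉ I) :
    α ^ u ∈ ZI q m α r I := by
  rcases hwt.lt_or_eq with h | h
  · exact Or.inl ⟨u, hu0, hu, by omega, rfl⟩
  · refine Or.inr (Set.mem_biUnion ⟨natAbs_altSum_mem_M q m u r hq h, hI h⟩ ⟨u, hu, h, ?_, rfl⟩)
    rw [abs_sub_comm, ← altSum_eq, Int.natCast_natAbs]

section MinDist

variable {ι F : Type*} [Fintype ι] [Field F] [DecidableEq F] (C : Submodule F (ι → F))

lemma minDist_le {x : ι → F} (hx : x ∈ C) (h0 : x ≠ 0) : minDist C ≤ hammingNorm x :=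
  Nat.sInf_le ⟨x, hx, 0, C.zero_mem, h0, by simp⟩

/-- The nonzero codeword is needed: the minimum distance of the zero code is `sInf ∅ = 0`. -/
lemma le_minDist {d : ℕ} (hne : ∃ x ∈ C, x ≠ 0) (h : ∀ x ∈ C, x ≠ 0 → d ≤ hammingNorm x) :
    d ≤ minDist C := by
  obtain ⟨x, hx, h0⟩ := hne
  refine le_csInf ⟨_, x, hx, 0, C.zero_mem, h0, rfl⟩ ?_
  rintro _ ⟨y, hy, z, hz, hyz, rfl⟩
  rw [hammingDist_eq_hammingNorm]
  exact h _ (C.add_mem (C.neg_mem hy) hz) (neg_add_eq_zero.not.mpr hyz)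

end MinDist

/-! ### Power sums of polynomial functions -/

section Polynomials

open MvPolynomial

variable {F K : Type*} [Field F] [Field K] [Algebra F K]

/-- A polynomial over an extension of `F`, of degree less than `n (q - 1)`, sums to zero over the
`F`-rational points. -/
lemma sum_eval_algebraMap_eq_zero [Fintype F] {σ : Type*} [Fintype σ] [DecidableEq σ]
    (f : MvPolynomial σ K)
    (h : f.totalDegree < (Fintype.card F - 1) * Fintype.card σ) :
    ∑ x : σ → F, eval (fun i => algebraMap F K (x i)) f = 0 := by
  simp only [eval_eq']
  rw [Finset.sum_comm]
  refine Finset.sum_eq_zero fun d hd => ?_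
  rw [← Finset.mul_sum]
  obtain ⟨i, hi⟩ := f.exists_degree_lt (Fintype.card F - 1) h hd
  have : ∑ x : σ → F, ∏ j, algebraMap F K (x j) ^ d j = ∏ j, ∑ a : F, algebraMap F K a ^ d j := by
    rw [Finset.prod_univ_sum, Fintype.piFinset_univ]
  rw [this, Finset.prod_eq_zero (Finset.mem_univ i), mul_zero]
  simp only [← map_pow, ← map_sum, FiniteField.sum_pow_lt_card_sub_one F _ hi, map_zero]

/-- The polynomial of degree `wt_q(u)` that expresses `g ^ u` in the coordinates of `g`. -/
noncomputable def powPoly {n : ℕ} (q : ℕ) (b : Module.Basis (Fin n) F K) (u : ℕ) :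
    MvPolynomial (Fin n) K :=
  ∏ i ∈ Finset.range n, (∑ j, C (b j ^ q ^ i) * X j) ^ digit q u i

lemma totalDegree_powPoly_le {n : ℕ} (q : ℕ) (b : Module.Basis (Fin n) F K) (u : ℕ) :
    (powPoly q b u).totalDegree ≤ wt q n u := by
  refine (totalDegree_finsetProd _ _).trans (Finset.sum_le_sum fun i _ => ?_)
  refine (totalDegree_pow _ _).trans (mul_le_of_le_one_right (Nat.zero_le _) ?_)
  refine totalDegree_finsetSum_le fun j _ => (totalDegree_mul _ _).trans ?_
  rw [totalDegree_C, totalDegree_X, zero_add]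

lemma eval_powPoly [Fintype F] {n q : ℕ} (hq : Fintype.card F = q)
    (b : Module.Basis (Fin n) F K) (u : ℕ)
    (hu : u < q ^ n) (x : Fin n → F) :
    eval (fun i => algebraMap F K (x i)) (powPoly q b u) = (b.equivFun.symm x) ^ u := by
  have hfrob : ∀ (i : ℕ) (y : K), (FiniteField.frobeniusAlgHom F K ^ i) y = y ^ q ^ i := by
    intro i
    induction i with
    | zero => simp
    | succ i ih => intro y; simp [pow_succ, ih, hq, ← pow_mul, mul_comm]
  have hlin : ∀ i, ∑ j, b j ^ q ^ i * algebraMap F K (x j) = (b.equivFun.symm x) ^ q ^ i := by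
    intro i
    rw [← hfrob, Module.Basis.equivFun_symm_apply, map_sum]
    refine Finset.sum_congr rfl fun j _ => ?_
    rw [map_smul, hfrob, Algebra.smul_def, mul_comm]
  have hsum := sum_digit_mul_pow q n u
  rw [Nat.mod_eq_of_lt hu] at hsum
  simp only [powPoly, eval_prod, eval_pow, map_sum, map_mul, eval_C, eval_X, hlin]
  conv_rhs => rw [← hsum, ← Finset.prod_pow_eq_pow_sum]
  exact Finset.prod_congr rfl fun i _ => by rw [← pow_mul, mul_comm]

/-- Power sums of a polynomial function of degree `r` vanish at exponents of weight less than
`n (q - 1) - r`. -/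
lemma sum_eval_mul_pow_eq_zero [Fintype F] [Fintype K] {n q : ℕ} (hq : Fintype.card F = q)
    (b : Module.Basis (Fin n) F K) (f : MvPolynomial (Fin n) F) (u : ℕ) (hu : u < q ^ n)
    (hdeg : f.totalDegree + wt q n u < n * (q - 1)) :
    ∑ g : K, algebraMap F K (eval (b.equivFun g) f) * g ^ u = 0 := by
  rw [← Equiv.sum_comp b.equivFun.symm.toEquiv]
  have h := sum_eval_algebraMap_eq_zero (F := F) (map (algebraMap F K) f * powPoly q b u) (by
    rw [hq, Fintype.card_fin, mul_comm _ n]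
    have h1 : (map (algebraMap F K) f).totalDegree ≤ f.totalDegree :=
      Finset.sup_mono (support_map_subset _ f)
    have h2 := totalDegree_powPoly_le q b u
    have h3 := totalDegree_mul (map (algebraMap F K) f) (powPoly q b u)
    omega)
  refine (Finset.sum_congr rfl fun x _ => ?_).trans h
  rw [map_mul, eval_powPoly hq b u hu]
  congr 1
  rw [eval_map, show b.equivFun (b.equivFun.symm.toEquiv x) = x from
    b.equivFun.apply_symm_apply x, ← eval₂_id, eval₂_comp_left]
  rfl

end Polynomials

/-! ### A Reed-Muller codeword of least weight -/

section Codeword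

open MvPolynomial

variable {F : Type*} [Field F] [Fintype F]

/-- The polynomial `∏_{j < ρ} (1 - X_j ^ (q - 1)) ∏_{a ∈ S} (X_ρ - a)`. -/
noncomputable def minWeightPoly {n : ℕ} (ρ : Fin n) (S : Finset F) : MvPolynomial (Fin n) F :=
  (∏ j ∈ Finset.Iio ρ, (1 - X j ^ (Fintype.card F - 1))) * ∏ a ∈ S, (X ρ - C a)

lemma totalDegree_minWeightPoly_le {n : ℕ} (ρ : Fin n) (S : Finset F) :
    (minWeightPoly ρ S).totalDegree ≤ ρ * (Fintype.card F - 1) + S.card := by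
  refine (totalDegree_mul _ _).trans (Nat.add_le_add ?_ ?_)
  · refine (totalDegree_finsetProd _ _).trans ?_
    refine (Finset.sum_le_card_nsmul _ _ (Fintype.card F - 1) fun j _ => ?_).trans
      (by rw [Fin.card_Iio, smul_eq_mul])
    refine (totalDegree_sub _ _).trans ?_
    rw [totalDegree_one, totalDegree_X_pow]
    simp
  · refine (totalDegree_finsetProd _ _).trans ?_
    refine (Finset.sum_le_card_nsmul _ _ 1 fun a _ => ?_).trans (by simp)
    refine (totalDegree_sub _ _).trans ?_
    rw [totalDegree_X, totalDegree_C]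
    simp

lemma eval_minWeightPoly_ne_zero_iff {n : ℕ} (ρ : Fin n) (S : Finset F) (x : Fin n → F) :
    eval x (minWeightPoly ρ S) ≠ 0 ↔ (∀ j < ρ, x j = 0) ∧ x ρ ∉ S := by
  have hq : 1 < Fintype.card F := Fintype.one_lt_card
  rw [minWeightPoly, map_mul, mul_ne_zero_iff, eval_prod, eval_prod, Finset.prod_ne_zero_iff,
    Finset.prod_ne_zero_iff]
  refine and_congr ?_ ?_
  · refine forall_congr' fun j => ?_
    rw [Finset.mem_Iio]
    refine imp_congr_right fun _ => ?_
    by_cases h : x j = 0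
    · simp [h, show Fintype.card F - 1 ≠ 0 by omega]
    · simp [h, FiniteField.pow_card_sub_one_eq_one]
  · simp only [map_sub, eval_X, eval_C, sub_ne_zero]
    exact ⟨fun h hmem => h _ hmem rfl, fun h a ha hax => h (hax ▸ ha)⟩

lemma card_eval_minWeightPoly_ne_zero [DecidableEq F] {n : ℕ} (ρ : Fin n) (S : Finset F) :
    (Finset.univ.filter fun x : Fin n → F => eval x (minWeightPoly ρ S) ≠ 0).card =
      (Fintype.card F - S.card) * Fintype.card F ^ (n - ρ - 1) := by
  have h : (Finset.univ.filter fun x : Fin n → F => eval x (minWeightPoly ρ S) ≠ 0) =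
      Fintype.piFinset fun j => if j < ρ then {0} else if j = ρ then Sᶜ else Finset.univ := by
    ext x
    rw [Finset.mem_filter, eval_minWeightPoly_ne_zero_iff, Fintype.mem_piFinset]
    simp only [Finset.mem_univ, true_and]
    constructor
    · rintro ⟨h1, h2⟩ j
      split_ifs with hj hj'
      · simpa using h1 j hj
      · simpa [hj'] using h2
      · simp
    · intro h
      refine ⟨fun j hj => ?_, ?_⟩
      · simpa [hj] using h j
      · simpa using h ρ
  rw [h, Fintype.card_piFinset, ← Finset.mul_prod_erase _ _ (Finset.mem_univ ρ)]
  congr 1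
  · simp [Finset.card_compl]
  · have hIoi : Finset.Ioi ρ ⊆ Finset.univ.erase ρ := fun j hj =>
      Finset.mem_erase.mpr ⟨(Finset.mem_Ioi.mp hj).ne', Finset.mem_univ _⟩
    rw [← Finset.prod_subset hIoi, Finset.prod_congr rfl (g := fun _ => Fintype.card F),
      Finset.prod_const, Fin.card_Ioi]
    · congr 1
      omega
    · intro j hj
      have := Finset.mem_Ioi.mp hj
      simp [this.not_gt, this.ne']
    · intro j hj hj'
      have h1 := Finset.ne_of_mem_erase hj
      rw [Finset.mem_Ioi, not_lt] at hj'
      simp [lt_of_le_of_ne hj' h1]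

variable {K : Type*} [Field K] [Fintype K] [DecidableEq K] [Algebra F K]

/-- The Reed-Muller code of order `r` is contained in the sandwiched code `C_q(r + 1, I, n)`. The
bound on `r` keeps `1 = α ^ 0 = α ^ (q ^ n - 1)` out of the zero set. -/
lemma eval_mem_sandwichedCode (q m : ℕ) (hq : Fintype.card F = q)
    (hn : Module.finrank F K = 2 * m) (α : K) (hα : IsPrimitiveRoot α (q ^ (2 * m) - 1)) (r : ℕ)
    (hr : r + 2 ≤ 2 * m * (q - 1)) (I : Set ℕ) (b : Module.Basis (Fin (2 * m)) F K)
    (f : MvPolynomial (Fin (2 * m)) F) (hf : f.totalDegree ≤ r) :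
    (fun g => eval (b.equivFun g) f) ∈ sandwichedCode F q m α (r + 1) I := by
  have hq1 : 1 < q := hq ▸ Fintype.one_lt_card
  have hpos : 0 < q ^ (2 * m) := Nat.pow_pos (by omega)
  set x : K → F := fun g => eval (b.equivFun g) f with hx
  have key : ∀ u < q ^ (2 * m), wt q (2 * m) u + (r + 1) ≤ 2 * m * (q - 1) →
      ∑ g, algebraMap F K (x g) * g ^ u = 0 := fun u hu hwt =>
    sum_eval_mul_pow_eq_zero hq b f u hu (by omega)
  refine ⟨fun g : Kˣ => x g, ?_, ?_⟩
  · intro u hu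
    obtain ⟨v, hv, hwt, huv⟩ : ∃ v ≤ q ^ (2 * m) - 1,
        wt q (2 * m) v + (r + 1) ≤ 2 * m * (q - 1) ∧ (0 < v ∧ α ^ u = α ^ v) := by
      rcases hu with ⟨v, hv0, hv, hwt, h⟩ | hu
      · exact ⟨v, hv, by omega, hv0, h⟩
      · simp only [Set.mem_iUnion] at hu
        obtain ⟨k, -, v, hv, hwt, -, h⟩ := hu
        refine ⟨v, hv, hwt.le, Nat.pos_of_ne_zero ?_, h⟩
        rintro rfl
        rw [wt_zero_right] at hwt
        omega
    have hcardK : Fintype.card K = q ^ (2 * m) := by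
      rw [Module.card_eq_pow_finrank (K := F), hq, hn]
    have hmod : u ≡ v [MOD q ^ (2 * m) - 1] := by
      obtain ⟨a, rfl⟩ := hα.isUnit (by omega)
      rw [(IsPrimitiveRoot.coe_units_iff.mp hα).eq_orderOf]
      exact pow_eq_pow_iff_modEq.mp (Units.ext (by simpa using huv.2))
    have hpow : ∀ g : Kˣ, (g : K) ^ u = (g : K) ^ v := by
      intro g
      have h : orderOf g ∣ q ^ (2 * m) - 1 := by
        rw [← hcardK, ← Fintype.card_units]
        exact orderOf_dvd_card
      exact_mod_cast congrArg Units.val (pow_eq_pow_iff_modEq.mpr (hmod.of_dvd h))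
    have h := key v (by omega) hwt
    rw [sum_eq_zero_position_add_powerSum, zero_pow huv.1.ne', mul_zero, zero_add] at h
    rw [← h]
    simp only [powerSum, hpow]
  · have h0 := key 0 hpos (by rw [wt_zero_right]; omega)
    rw [sum_eq_zero_position_add_powerSum] at h0
    have h1 : x 0 = -∑ g : Kˣ, x g := by
      rw [eq_neg_iff_add_eq_zero]
      apply (algebraMap F K).injective
      simpa [powerSum] using h0
    funext g
    by_cases hg : g = 0
    · rw [hg, extendWord_apply_zero, h1]
    · exact extendWord_apply_unit _ (Units.mk0 g hg)

lemma exists_mem_sandwichedCode_hammingNorm [DecidableEq F] (q m : ℕ)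
    (hq : Fintype.card F = q) (hn : Module.finrank F K = 2 * m) (α : K)
    (hα : IsPrimitiveRoot α (q ^ (2 * m) - 1)) (r ρ s : ℕ) (hr : r + 2 ≤ 2 * m * (q - 1))
    (hrs : r = ρ * (q - 1) + s) (hρ : ρ < 2 * m) (hs : s < q - 1) (I : Set ℕ) :
    ∃ x ∈ sandwichedCode F q m α (r + 1) I, x ≠ 0 ∧
      hammingNorm x = (q - s) * q ^ (2 * m - ρ - 1) := by
  obtain ⟨S, -, hS⟩ := Finset.exists_subset_card_eq
    (show s ≤ (Finset.univ : Finset F).card by rw [Finset.card_univ, hq]; omega)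
  let b : Module.Basis (Fin (2 * m)) F K := Module.finBasisOfFinrankEq F K hn
  let x : K → F := fun g => eval (b.equivFun g) (minWeightPoly ⟨ρ, hρ⟩ S)
  have hw : hammingNorm x = (q - s) * q ^ (2 * m - ρ - 1) := by
    rw [← hS, ← hq, ← card_eval_minWeightPoly_ne_zero ⟨ρ, hρ⟩ S]
    exact Finset.card_equiv b.equivFun.toEquiv (fun g => by simp only [Finset.mem_filter_univ]; rfl)
  refine ⟨x, ?_, ?_, hw⟩
  · refine eval_mem_sandwichedCode q m hq hn α hα r hr I b _ ?_
    have := totalDegree_minWeightPoly_le (⟨ρ, hρ⟩ : Fin (2 * m)) S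
    rw [hS, hq] at this
    exact this.trans_eq hrs.symm
  · rw [← hammingNorm_pos_iff, hw]
    exact Nat.mul_pos (by omega) (Nat.pow_pos (by omega))

end Codeword

/-! ### The minimum distance of sandwiched Reed-Muller codes -/

section MinimumDistance

variable {F K : Type*} [Field F] [DecidableEq F] [Field K] [Fintype K] [DecidableEq K]
  [Algebra F K] {q m : ℕ} {α : K} {r ρ s : ℕ} {I : Set ℕ}

/-- The BCH bound for a designed distance `d ≤ (q - s) q ^ (n - ρ - 1)`: only the exponents whose
weight is one below the maximum have to be checked against `I`. -/
lemma le_hammingNorm_of_mem_sandwichedCode (hrs : r = ρ * (q - 1) + s) (hρ : ρ < 2 * m)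
    (hs : s < q - 1) (d : ℕ) (hd : d ≤ (q - s) * q ^ (2 * m - ρ - 1))
    (hI : ∀ u, u + 1 < d →
      wt q (2 * m) u + 1 = (2 * m - ρ - 1) * (q - 1) + (q - 1 - s) →
      (altSum q (2 * m) u).natAbs ∉ I)
    (x : K → F) (hx : x ∈ sandwichedCode F q m α (r + 1) I) (h0 : x ≠ 0) :
    d ≤ hammingNorm x := by
  have hq : 0 < q := by omega
  obtain ⟨k, hk⟩ : ∃ k, 2 * m = ρ + k + 1 := ⟨2 * m - ρ - 1, by omega⟩
  have hk' : 2 * m - ρ - 1 = k := by omega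
  rw [hk'] at hd hI
  have hbound : (q - s) * q ^ k ≤ q ^ (2 * m) := by
    calc (q - s) * q ^ k ≤ q * q ^ k := Nat.mul_le_mul_right _ (Nat.sub_le _ _)
      _ = q ^ (k + 1) := (pow_succ' q k).symm
      _ ≤ q ^ (2 * m) := Nat.pow_le_pow_right hq (by omega)
  have htotal : 2 * m * (q - 1) = ρ * (q - 1) + k * (q - 1) + (q - 1) := by rw [hk]; ring
  have := lt_hammingNorm_of_sum_pow_eq_zero x h0 (d - 1) fun u hu => by
    refine sum_pow_eq_zero_of_mem_sandwichedCode hx u fun hu0 => ?_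
    have hlt := (weight_lt_and_altSum_of_lt q s hs k (2 * m) u (by omega) (by omega)).1
    exact pow_mem_ZI q m α (r + 1) I u hq hu0 (by omega) (by omega)
      fun h => hI u (by omega) (by omega)
  omega

/-- When `I` avoids both values next to the extremal alternating sum, the BCH bound reaches the
minimum distance of the Reed-Muller code of order `r`. -/
lemma minDist_sandwichedCode_eq [Fintype F] (hq : Fintype.card F = q)
    (hn : Module.finrank F K = 2 * m)
    (hα : IsPrimitiveRoot α (q ^ (2 * m) - 1)) (hr : r + 2 ≤ 2 * m * (q - 1))
    (hrs : r = ρ * (q - 1) + s) (hρ : ρ < 2 * m) (hs : s < q - 1)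
    (hI : ∀ u, u + 1 < (q - s) * q ^ (2 * m - ρ - 1) →
      wt q (2 * m) u + 1 = (2 * m - ρ - 1) * (q - 1) + (q - 1 - s) →
      (altSum q (2 * m) u).natAbs ∉ I) :
    minDist (sandwichedCode F q m α (r + 1) I) = (q - s) * q ^ (2 * m - ρ - 1) := by
  obtain ⟨x, hx, h0, hw⟩ :=
    exists_mem_sandwichedCode_hammingNorm q m hq hn α hα r ρ s hr hrs hρ hs I
  exact le_antisymm (hw ▸ minDist_le _ hx h0)
    (le_minDist _ ⟨x, hx, h0⟩ (le_hammingNorm_of_mem_sandwichedCode hrs hρ hs _ le_rfl hI))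

end MinimumDistance

end SandwichedRM

open SandwichedRM in
theorem mainTheorem5 {F K : Type*} [Field F] [Fintype F] [DecidableEq F]
    [Field K] [Fintype K] [DecidableEq K] [Algebra F K]
    (q m : ℕ) (hm : 0 < m) (hq : Fintype.card F = q) (hn : Module.finrank F K = 2 * m)
    (α : K) (hα : IsPrimitiveRoot α (q ^ (2 * m) - 1))
    (r ρ s : ℕ) (hr : r + 2 ≤ 2 * m * (q - 1)) (hrs : r = ρ * (q - 1) + s)
    (hρ : ρ ≤ 2 * m - 1) (hs : s < q - 1)
    (I : Set ℕ) (hI : I ⊆ SandwichedRM.M q m (r + 1)) :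
    (ρ = 2 * m - 1 → ({q - 1 - s - 1} : Set ℕ) ∩ I = ∅ →
      SandwichedRM.minDist (SandwichedRM.sandwichedCode F q m α (r + 1) I) = q - s) ∧
    (ρ ≤ 2 * m - 2 →
      ((Odd ρ ∧ ({q - 1 - s + 1, q - 1 - s - 1} : Set ℕ) ∩ I = ∅) ∨
        (Even ρ ∧ ({((s : ℤ) + 1).natAbs, ((s : ℤ) - 1).natAbs} : Set ℕ) ∩ I = ∅) →
        SandwichedRM.minDist (SandwichedRM.sandwichedCode F q m α (r + 1) I) =
          (q - s) * q ^ (2 * m - ρ - 1)) ∧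
      ((Odd ρ ∧ ({q - 1 - s + 1, q - 1 - s - 1} : Set ℕ) ∩ I = {q - 1 - s + 1}) ∨
        (Even ρ ∧ s ≠ 0 ∧ ({((s : ℤ) + 1).natAbs, ((s : ℤ) - 1).natAbs} : Set ℕ) ∩ I =
          {((s : ℤ) - 1).natAbs}) →
        (q ^ 2 - q * s - 1) * q ^ (2 * m - ρ - 2) ≤
          SandwichedRM.minDist (SandwichedRM.sandwichedCode F q m α (r + 1) I))) := by
  have hρ' : ρ < 2 * m := by omega
  refine ⟨fun hρn hI1 => ?_, fun hρn => ⟨fun hI2 => ?_, fun hI2 => ?_⟩⟩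
  · have hk : 2 * m - ρ - 1 = 0 := by omega
    have hnot : q - 1 - s - 1 ∉ I := fun h => by
      have : q - 1 - s - 1 ∈ ({q - 1 - s - 1} : Set ℕ) ∩ I := ⟨rfl, h⟩
      simp [hI1] at this
    have h := minDist_sandwichedCode_eq (I := I) hq hn hα hr hrs hρ' hs fun u hu hwt => by
      rw [hk, pow_zero, mul_one] at hu
      rw [hk, zero_mul, zero_add] at hwt
      obtain ⟨n, hn'⟩ : ∃ n, 2 * m = n + 1 := ⟨2 * m - 1, by omega⟩
      have hlt : u < q := by omega
      rw [hn', wt_succ, Nat.mod_eq_of_lt hlt, Nat.div_eq_of_lt hlt, wt_zero_right] at hwt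
      rw [hn', altSum_succ, Nat.mod_eq_of_lt hlt, Nat.div_eq_of_lt hlt, altSum_zero_right]
      rwa [show (((u : ℕ) : ℤ) - 0).natAbs = q - 1 - s - 1 by omega]
    rwa [hk, pow_zero, mul_one] at h
  · refine minDist_sandwichedCode_eq hq hn hα hr hrs hρ' hs fun u hu hwt hmem => ?_
    have halt := (weight_lt_and_altSum_of_lt q s hs _ (2 * m) u hu (by omega)).2 hwt
    rcases hI2 with ⟨hodd, hI2⟩ | ⟨heven, hI2⟩
    · have hK : Even (2 * m - ρ - 1) := by
        rw [Nat.odd_iff] at hodd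
        rw [Nat.even_iff]
        omega
      rw [maxAltSum, if_pos hK] at halt
      refine Set.eq_empty_iff_forall_notMem.mp hI2 _ ⟨?_, hmem⟩
      rw [Set.mem_insert_iff, Set.mem_singleton_iff]
      omega
    · have hK : ¬ Even (2 * m - ρ - 1) := by
        rw [Nat.even_iff] at heven ⊢
        omega
      rw [maxAltSum, if_neg hK] at halt
      refine Set.eq_empty_iff_forall_notMem.mp hI2 _ ⟨?_, hmem⟩
      rw [Set.mem_insert_iff, Set.mem_singleton_iff]
      omega
  · obtain ⟨x, hx, h0, -⟩ :=
      exists_mem_sandwichedCode_hammingNorm q m hq hn α hα r ρ s hr hrs hρ' hs I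
    have hk : 2 * m - ρ - 1 = 2 * m - ρ - 2 + 1 := by omega
    refine le_minDist _ ⟨x, hx, h0⟩ (le_hammingNorm_of_mem_sandwichedCode hrs hρ' hs _ ?_ ?_)
    · rw [hk, pow_succ' q (2 * m - ρ - 2), ← mul_assoc, Nat.sub_mul q s q, sq, mul_comm s q]
      exact Nat.mul_le_mul_right _ (Nat.sub_le _ _)
    · intro u hu hwt hmem
      rw [hk] at hwt
      have halt := altSum_of_lt_second q s hs _ (2 * m) u hu (by omega) hwt
      rcases hI2 with ⟨hodd, hI2⟩ | ⟨heven, hs0, hI2⟩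
      · rw [Nat.odd_iff] at hodd
        rw [maxAltSum, if_pos (by rw [Nat.even_iff]; omega),
          if_neg (by rw [Nat.even_iff]; omega)] at halt
        have h : (altSum q (2 * m) u).natAbs ∈
            ({q - 1 - s + 1, q - 1 - s - 1} : Set ℕ) ∩ I :=
          ⟨Or.inr (by rw [Set.mem_singleton_iff]; omega), hmem⟩
        rw [hI2, Set.mem_singleton_iff] at h
        omega
      · rw [Nat.even_iff] at heven
        rw [maxAltSum, if_neg (by rw [Nat.even_iff]; omega),
          if_pos (by rw [Nat.even_iff]; omega)] at halt
        have h : (altSum q (2 * m) u).natAbs ∈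
            ({((s : ℤ) + 1).natAbs, ((s : ℤ) - 1).natAbs} : Set ℕ) ∩ I :=
          ⟨Or.inl (by rw [halt]), hmem⟩
        rw [hI2, Set.mem_singleton_iff] at h
        omega
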